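/- Let $\mathbb{F}_q$ be the finite field with $q$ elements and let $K=\overline{\mathbb{F}}_q$ be its algebraic closure. A \emph{partial spread} of $\mathbb{P}^3_{\mathbb{F}_q}$ is a set $S$ of mutually skew lines of $\mathbb{P}^3_{\mathbb{F}_q}$; write $s=|S|$, and let $\mathcal{P}(S)\subseteq\mathbb{P}^3_{\mathbb{F}_q}\subseteq\mathbb{P}^3_K$ be the set of all $\mathbb{F}_q$-points on the lines of $S$. A finite set $Z\subseteq\mathbb{P}^3_K$ is \emph{$\{a,b\}$-geproci} if, for a general point $P\in\mathbb{P}^3_K$, the image of $Z$ under projection from $P$ to a plane $H\not\ni P$ is (as a reduced scheme) the complete intersection in $H\cong\mathbb{P}^2_K$ of a curve of degree $a$ and a curve of degree $b$, i.e. its homogeneous ideal is generated by a form of degree $a$ and a form of degree $b$ without common factor; neither $a\le b$ nor $b\le a$ is required. If $S$ is a partial spread of $s$ lines in $\mathbb{P}^3_{\mathbb{F}_q}$, then $\mathcal{P}(S)$ is $\{s,q+1\}$-geproci. Moreover, for a general point $P=(a,b,c,d)\in\mathbb{P}^3_K$, the following cones with vertex $P$ realize this. Let $$F=\det\begin{pmatrix}a&b&c&d\\a^q&b^q&c^q&d^q\\x&y&z&w\\x^q&y^q&z^q&w^q\end{pmatrix}.$$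 This is a nonzero form of degree $q+1$ with multiplicity $q+1$ at $P$. There is a nonzero form $G$ of degree $s$, with multiplicity $s$ at $P$, whose zero set in $\mathbb{P}^3_K$ is the join of the lines of $S$ with $P$ (the union of the planes spanned by $P$ and the lines of $S$). For every plane $H\not\ni P$, the projection of $\mathcal{P}(S)$ from $P$ to $H$ is the complete intersection of the curves defined by $G|_H$ and $F|_H$, of degrees $s$ and $q+1$. -/

import Mathlib

open scoped LinearAlgebra.Projectivization

noncomputable section

namespace Geproci

/-! ### Projective sets, forms and general points -/

section Projective

variable {K : Type*} [Field K] {n : ℕ}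

/-- The nonzero vectors that represent the points of `X`, a set of points of the projective space
with homogeneous coordinates indexed by `Fin n`. -/
def puncturedCone (X : Set (ℙ K (Fin n → K))) : Set (Fin n → K) :=
  {v | ∃ hv : v ≠ 0, Projectivization.mk K v hv ∈ X}

/-- The ideal of a set of points of projective space: all polynomials that vanish at all
homogeneous coordinate vectors of its points. Over an infinite field this is the usual
homogeneous ideal `I(X)`. -/
def homogeneousIdeal (X : Set (ℙ K (Fin n → K))) : Ideal (MvPolynomial (Fin n) K) :=
  MvPolynomial.vanishingIdeal K (puncturedCone X)

/-- The points of projective space where the form `f` vanishes (for a form, the choice of the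
representative does not matter). -/
def zeroSet (f : MvPolynomial (Fin n) K) : Set (ℙ K (Fin n → K)) :=
  {Q | MvPolynomial.eval Q.rep f = 0}

/-- Zariski open subsets of projective space: complements of common zero sets of families of
homogeneous polynomials. -/
def IsZariskiOpen (U : Set (ℙ K (Fin n → K))) : Prop :=
  ∃ T : Set (MvPolynomial (Fin n) K), (∀ f ∈ T, ∃ d, f.IsHomogeneous d) ∧
    U = (⋂ f ∈ T, zeroSet f)ᶜ

/-- A property holds for a general point if it holds on a nonempty Zariski open set. -/
def ForGeneralPoint (p : ℙ K (Fin n → K) → Prop) : Prop :=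
  ∃ U : Set (ℙ K (Fin n → K)), IsZariskiOpen U ∧ U.Nonempty ∧ ∀ P ∈ U, p P

/-- `f` defines a cone of degree `d` with vertex `P`: a hypersurface of degree `d` that has
multiplicity (at least) `d` at `P`. -/
def IsConeWithVertex (P : ℙ K (Fin n → K)) (d : ℕ) (f : MvPolynomial (Fin n) K) : Prop :=
  f ≠ 0 ∧ f.IsHomogeneous d ∧ f ∈ homogeneousIdeal {P} ^ d

end Projective

/-! ### Projection to a plane, complete intersections, the geproci property -/

section Geproci

variable {K : Type*} [Field K]

/-- The linear map that induces the projection from the point `P` of projective 3-space to the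
plane `H` not containing `P`, written in the linear coordinates `e` on `H`. -/
def projectionFrom (P : ℙ K (Fin 4 → K)) (H : Submodule K (Fin 4 → K))
    (h : IsCompl H P.submodule) (e : H ≃ₗ[K] (Fin 3 → K)) : (Fin 4 → K) →ₗ[K] (Fin 3 → K) :=
  e.toLinearMap ∘ₗ H.projectionOnto P.submodule h

/-- The image of a set of points under the map of projective spaces induced by a linear map
(points on which the map is not defined are dropped). -/
def imageUnder (φ : (Fin 4 → K) →ₗ[K] (Fin 3 → K)) (Z : Set (ℙ K (Fin 4 → K))) :
    Set (ℙ K (Fin 3 → K)) :=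
  {Q | ∃ z ∈ Z, Q.submodule = z.submodule.map φ}

/-- The restriction of a form to the plane `H`, written in the linear coordinates `e` on `H`. -/
def restrictToPlane (H : Submodule K (Fin 4 → K)) (e : H ≃ₗ[K] (Fin 3 → K))
    (f : MvPolynomial (Fin 4) K) : MvPolynomial (Fin 3) K :=
  MvPolynomial.aeval (fun i : Fin 4 =>
    ∑ j : Fin 3, MvPolynomial.C ((e.symm (Pi.single j 1) : Fin 4 → K) i) * MvPolynomial.X j) f

/-- The finite set of points `X` of the projective plane is (as a reduced scheme) the complete
intersection of the curve of degree `a` defined by `f` and the curve of degree `b` defined by `g`: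
these curves have no common component and `f`, `g` generate the homogeneous ideal of `X`. -/
def IsCompleteIntersectionOf (X : Set (ℙ K (Fin 3 → K))) (a b : ℕ)
    (f g : MvPolynomial (Fin 3) K) : Prop :=
  f ≠ 0 ∧ f.IsHomogeneous a ∧ g ≠ 0 ∧ g.IsHomogeneous b ∧ IsRelPrime f g ∧
    homogeneousIdeal X = Ideal.span {f, g}

/-- `Z` is `{a, b}`-geproci: a finite set whose projection from a general point `P` to a plane is a
complete intersection of a curve of degree `a` and a curve of degree `b`. Neither `a ≤ b` nor
`b ≤ a` is required. -/
def IsGeproci (Z : Set (ℙ K (Fin 4 → K))) (a b : ℕ) : Prop :=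
  Z.Finite ∧ ForGeneralPoint fun P : ℙ K (Fin 4 → K) =>
    P ∉ Z ∧ ∀ (H : Submodule K (Fin 4 → K)) (h : IsCompl H P.submodule)
      (e : H ≃ₗ[K] (Fin 3 → K)),
      ∃ f g, IsCompleteIntersectionOf (imageUnder (projectionFrom P H h e) Z) a b f g

end Geproci

/-! ### Partial spreads and the two cones -/

section Spread

variable {F : Type*} [Field F]

/-- A partial spread of projective 3-space over `F`: a finite set of mutually skew lines, a line
being given as a 2-dimensional linear subspace. -/
def IsPartialSpread (S : Finset (Submodule F (Fin 4 → F))) : Prop :=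
  (∀ L ∈ S, Module.finrank F L = 2) ∧ ∀ L ∈ S, ∀ L' ∈ S, L ≠ L' → Disjoint L L'

variable (K : Type*) [Field K] [Algebra F K]

/-- The inclusion of `F`-rational vectors. -/
def inclusion : (Fin 4 → F) →ₛₗ[algebraMap F K] (Fin 4 → K) where
  toFun v i := algebraMap F K (v i)
  map_add' _ _ := funext fun _ => map_add _ _ _
  map_smul' _ _ := funext fun _ => map_mul _ _ _

theorem inclusion_injective : Function.Injective (inclusion (F := F) K) := fun _ _ h =>
  funext fun i => (algebraMap F K).injective (congrFun h i)

/-- The inclusion of projective 3-space over `F` in projective 3-space over `K`. -/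
def includePoint : ℙ F (Fin 4 → F) → ℙ K (Fin 4 → K) :=
  Projectivization.map (inclusion K) (inclusion_injective K)

/-- The set of `F`-points on the lines of `S`, as a set of points of projective 3-space
over `K`. -/
def pointsOf (S : Finset (Submodule F (Fin 4 → F))) : Set (ℙ K (Fin 4 → K)) :=
  includePoint K '' {z : ℙ F (Fin 4 → F) | ∃ L ∈ S, z.submodule ≤ L}

/-- The line over `K` (all of its `K`-points) spanned by a line over `F`. -/
def extendLine (L : Submodule F (Fin 4 → F)) : Submodule K (Fin 4 → K) :=
  Submodule.span K (inclusion K '' (L : Set (Fin 4 → F)))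

/-- The join of the lines of `S` with the point `P`: the union of the linear spans of `P` with
the lines of `S`. -/
def join (S : Finset (Submodule F (Fin 4 → F))) (P : ℙ K (Fin 4 → K)) : Set (ℙ K (Fin 4 → K)) :=
  {Q | ∃ L ∈ S, Q.submodule ≤ P.submodule ⊔ extendLine K L}

variable {K}

/-- The determinant of the matrix with rows `p`, `p ^ q`, `(x, y, z, w)` and
`(x ^ q, y ^ q, z ^ q, w ^ q)`, where `p ^ q` is taken coordinatewise. -/
def detForm (q : ℕ) (p : Fin 4 → K) : MvPolynomial (Fin 4) K :=
  Matrix.det (Matrix.of ![fun i => MvPolynomial.C (p i), fun i => MvPolynomial.C (p i ^ q),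
    fun i => MvPolynomial.X i, fun i => MvPolynomial.X i ^ q])

end Spread

end Geproci

end

open Geproci

namespace Geproci

open MvPolynomial

/-! ### Commutative algebra: gluing ideals, Frobenius, polynomials. -/

section Algebra

/-! Call P general if its coordinates are linearly independent over F (`IsFree`), i.e. P lies on
none of the finitely many F-rational planes; this is a nonempty open condition
(`forGeneralPoint_isFree`). The form G is the product of the linear forms `joinForm` defining the
planes PL, L ∈ S. Both G and `detForm` are invariant under x ↦ x + tP, so their restrictions to H
take at a projected point the values they take at the point itself.

In F-rational coordinates with L = {x₂ = x₃ = 0}, `detForm` restricted to L is a nonzero constant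
times x₀x₁^q - x₀^q x₁, which is squarefree with exactly the q + 1 rational points of L as zeros.
Hence the ideal of the projected points of L is generated by the linear form of PL and `detForm`,
both restricted to H (`lineIdeal_le`).

A rational point w of another line L' is not on L, so L and w span a rational plane, which misses P;
thus the linear form of PL does not vanish at w and is regular modulo the ideal of L'. By
`mem_span_prod_pair` the intersection of the ideals of all lines is then generated by G and
`detForm` restricted to H. -/

theorem mem_span_prod_pair {R ι : Type*} [CommRing R] [DecidableEq ι] (S : Finset ι)
    (I : ι → Ideal R) (l : ι → R) (g : R) (hl : ∀ i ∈ S, I i ≤ Ideal.span {l i, g})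
    (hg : ∀ i ∈ S, g ∈ I i)
    (hreg : ∀ i ∈ S, ∀ j ∈ S, i ≠ j → ∀ f, l i * f ∈ I j → f ∈ I j)
    {f : R} (hf : ∀ i ∈ S, f ∈ I i) : f ∈ Ideal.span {∏ i ∈ S, l i, g} := by
  induction S using Finset.induction_on generalizing f with
  | empty =>
    rw [Finset.prod_empty, Ideal.mem_span_pair]
    exact ⟨f, 0, by ring⟩
  | insert i S hi ih =>
    obtain ⟨a, b, rfl⟩ := Ideal.mem_span_pair.1
      (hl i (Finset.mem_insert_self i S) (hf i (Finset.mem_insert_self i S)))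
    -- The element is now `a * l i + b * g`. It and `g` lie in each other `I j`, hence so does `l i
    -- * a`; regularity of `l i` modulo `I j` removes the factor, and induction applies to `a`.
    have ha : a ∈ Ideal.span {∏ i ∈ S, l i, g} := by
      refine ih (fun j hj => hl j (Finset.mem_insert_of_mem hj))
        (fun j hj => hg j (Finset.mem_insert_of_mem hj))
        (fun j hj k hk => hreg j (Finset.mem_insert_of_mem hj) k (Finset.mem_insert_of_mem hk))
        fun j hj => ?_
      refine hreg i (Finset.mem_insert_self i S) j (Finset.mem_insert_of_mem hj)
        (fun h => hi (h ▸ hj)) _ ?_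
      have h := (I j).sub_mem (hf j (Finset.mem_insert_of_mem hj))
        ((I j).mul_mem_left b (hg j (Finset.mem_insert_of_mem hj)))
      rwa [add_sub_cancel_right, mul_comm] at h
    obtain ⟨c, d, rfl⟩ := Ideal.mem_span_pair.1 ha
    rw [Ideal.mem_span_pair, Finset.prod_insert hi]
    exact ⟨c, d * l i + b, by ring⟩

/-! ### The q-power map and its fixed points. -/

section FiniteField

variable (F : Type*) [Field F] [Finite F]

theorem add_pow_natCard {R : Type*} [CommRing R] [Algebra F R] (x y : R) :
    (x + y) ^ Nat.card F = x ^ Nat.card F + y ^ Nat.card F := by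
  have := Fintype.ofFinite F
  rw [Nat.card_eq_fintype_card]
  exact map_add (FiniteField.frobeniusAlgHom F R) x y

theorem sum_pow_natCard {R ι : Type*} [CommRing R] [Algebra F R] (s : Finset ι) (x : ι → R) :
    (∑ i ∈ s, x i) ^ Nat.card F = ∑ i ∈ s, x i ^ Nat.card F := by
  have := Fintype.ofFinite F
  rw [Nat.card_eq_fintype_card]
  exact map_sum (FiniteField.frobeniusAlgHom F R) x s

theorem pow_natCard (a : F) : a ^ Nat.card F = a := by
  have := Fintype.ofFinite F
  rw [Nat.card_eq_fintype_card, FiniteField.pow_card]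

theorem algebraMap_pow_natCard {R : Type*} [CommRing R] [Algebra F R] (a : F) :
    algebraMap F R a ^ Nat.card F = algebraMap F R a := by
  rw [← map_pow, pow_natCard]

theorem cast_natCard_eq_zero {R : Type*} [CommRing R] [Algebra F R] :
    (Nat.card F : R) = 0 := by
  have := Fintype.ofFinite F
  rw [Nat.card_eq_fintype_card, ← map_natCast (algebraMap F R), FiniteField.cast_card_eq_zero,
    map_zero]

/-- The polynomial X^q - X has at most q roots, and F already supplies q of them. -/
theorem exists_algebraMap_eq_of_pow_natCard_eq {K : Type*} [Field K] [Algebra F K] {x : K}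
    (hx : x ^ Nat.card F = x) : ∃ a : F, algebraMap F K a = x := by
  classical
  have := Fintype.ofFinite F
  have hq : 1 < Fintype.card F := Fintype.one_lt_card
  rw [Nat.card_eq_fintype_card] at hx
  have hne := FiniteField.X_pow_card_sub_X_ne_zero K hq
  have hsub : (Finset.univ.image (algebraMap F K)) ⊆
      (Polynomial.X ^ Fintype.card F - Polynomial.X : Polynomial K).roots.toFinset := by
    intro y hy
    obtain ⟨a, -, rfl⟩ := Finset.mem_image.1 hy
    simp [hne, ← map_pow, FiniteField.pow_card]
  have heq := Finset.eq_of_subset_of_card_le hsub (by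
    rw [Finset.card_image_of_injective _ (algebraMap F K).injective, Finset.card_univ]
    refine (Multiset.toFinset_card_le _).trans ((Polynomial.card_roots' _).trans ?_)
    rw [FiniteField.X_pow_card_sub_X_natDegree_eq K hq])
  have hmem : x ∈ Finset.univ.image (algebraMap F K) := by
    rw [heq]
    simp [hne, hx]
  simpa using hmem

/-- The zeros of `α β ^ q - α ^ q β` are the multiples of the rational vectors. -/
theorem exists_smul_of_mul_pow_eq {K : Type*} [Field K] [Algebra F K] {α β : K}
    (h : α * β ^ Nat.card F = α ^ Nat.card F * β) :
    ∃ (t : K) (a b : F), α = t * algebraMap F K a ∧ β = t * algebraMap F K b := by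
  by_cases hα : α = 0
  · exact ⟨β, 0, 1, by simp [hα], by simp⟩
  · obtain ⟨c, hc⟩ := exists_algebraMap_eq_of_pow_natCard_eq F (x := β / α) (by
      rw [div_pow, div_eq_div_iff (pow_ne_zero _ hα) hα]
      linear_combination h)
    exact ⟨α, 1, c, by simp, by rw [hc]; field_simp⟩

end FiniteField

/-! ### Squarefree polynomials, Nullstellensatz, linear substitution. -/

section Polynomials

variable {K : Type*} [Field K] {n m : ℕ}

/-- A square factor g² forces g to divide both partial derivatives, which are X₁^q and -X₀^q because
q = 0 in K; these are coprime. -/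
theorem squarefree_X_mul_X_pow_sub {q : ℕ} (hq : (q : K) = 0) :
    Squarefree (X 0 * X 1 ^ q - X 0 ^ q * X 1 : MvPolynomial (Fin 2) K) := by
  have hqC : (q : MvPolynomial (Fin 2) K) = 0 := by rw [← map_natCast C, hq, map_zero]
  have key : ∀ (i : Fin 2) (g M : MvPolynomial (Fin 2) K), g * g ∣ M → g ∣ pderiv i M := by
    rintro i g _ ⟨h, rfl⟩
    rw [Derivation.leibniz, Derivation.leibniz]
    simp only [smul_eq_mul]
    exact ⟨g * pderiv i h + h * (pderiv i g + pderiv i g), by ring⟩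
  intro g hg
  have h0 := key 0 g _ hg
  have h1 := key 1 g _ hg
  simp [pderiv_X, Derivation.leibniz_pow, hqC] at h0 h1
  have hrel : IsRelPrime (X 0 ^ q : MvPolynomial (Fin 2) K) (X 1 ^ q) := by
    refine IsRelPrime.pow ?_
    rw [(X_prime (i := 0)).irreducible.isRelPrime_iff_not_dvd]
    rw [X_dvd_X]
    simp
  exact hrel h1 h0

/-- A polynomial that vanishes at the zeros of a squarefree polynomial is divisible by it. -/
theorem dvd_of_squarefree_of_eval_eq_zero [IsAlgClosed K] {g f : MvPolynomial (Fin n) K}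
    (hg : Squarefree g) (h : ∀ x, eval x g = 0 → eval x f = 0) : g ∣ f := by
  have hf : f ∈ vanishingIdeal K (zeroLocus K (Ideal.span {g})) := by
    intro x hx
    rw [zeroLocus_span] at hx
    exact h x (hx g rfl)
  rw [vanishingIdeal_zeroLocus_eq_radical, Ideal.mem_radical_iff] at hf
  obtain ⟨k, hk⟩ := hf
  exact hg.isRadical k f (Ideal.mem_span_singleton.1 hk)

theorem irreducible_of_isHomogeneous_one {l : MvPolynomial (Fin n) K} (hl : l.IsHomogeneous 1)
    (h0 : l ≠ 0) : Irreducible l := by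
  refine irreducible_of_totalDegree_eq_one (hl.totalDegree h0) fun x hx => ?_
  obtain ⟨d, hd⟩ := MvPolynomial.ne_zero_iff.1 h0
  exact isUnit_of_dvd_unit (hx d) (isUnit_iff_ne_zero.2 hd)

/-- Ideals of projective sets test only nonzero vectors, whereas the Nullstellensatz argument in
`lineIdeal_le` also meets the origin. -/
theorem eval_zero_eq_zero_of_eval_smul [Infinite K] (f : MvPolynomial (Fin n) K) (v : Fin n → K)
    (h : ∀ t : K, t ≠ 0 → eval (t • v) f = 0) : eval 0 f = 0 := by
  let p : Polynomial K := aeval (fun i => Polynomial.X * Polynomial.C (v i)) f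
  have hp : ∀ t, p.eval t = eval (t • v) f := by
    intro t
    simp only [p]
    rw [← Polynomial.coe_evalRingHom, ← RingHom.coe_coe (aeval _), ← RingHom.comp_apply]
    congr 1
    ext i
    · simp
    · simp
      ring
  -- The factor X takes care of t = 0, where nothing is known about `p`.
  have hz : Polynomial.X * p = 0 := by
    refine Polynomial.funext fun t => ?_
    by_cases ht : t = 0
    · simp [ht]
    · simp [hp, h t ht]
  have h0 : p = 0 := (mul_eq_zero.1 hz).resolve_left Polynomial.X_ne_zero
  have := hp 0
  rwa [h0, zero_smul, Polynomial.eval_zero, eq_comm] at this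

/-- The polynomial function `f` composed with the linear map `T`. -/
noncomputable def pullback (T : (Fin m → K) →ₗ[K] (Fin n → K)) :
    MvPolynomial (Fin n) K →ₐ[K] MvPolynomial (Fin m) K :=
  aeval fun i => ∑ j, C (T (Pi.single j 1) i) * X j

theorem eval_pullback (T : (Fin m → K) →ₗ[K] (Fin n → K)) (f : MvPolynomial (Fin n) K)
    (y : Fin m → K) : eval y (pullback T f) = eval (T y) f := by
  have hT : ∀ i, T y i = ∑ j, T (Pi.single j 1) i * y j := by
    intro i
    conv_lhs => rw [pi_eq_sum_univ' y, map_sum, Finset.sum_apply]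
    refine Finset.sum_congr rfl fun j _ => ?_
    rw [map_smul, Pi.smul_apply, smul_eq_mul, mul_comm]
  rw [pullback, ← RingHom.coe_coe (aeval _), ← RingHom.comp_apply]
  congr 1
  ext i
  · simp
  · simp [hT]

theorem isHomogeneous_pullback (T : (Fin m → K) →ₗ[K] (Fin n → K)) {f : MvPolynomial (Fin n) K}
    {d : ℕ} (hf : f.IsHomogeneous d) : (pullback T f).IsHomogeneous d := by
  have := hf.aeval (fun i => ∑ j, C (T (Pi.single j 1) i) * X j : Fin n → MvPolynomial (Fin m) K)
    (n := 1) fun i => IsHomogeneous.sum _ _ _ fun j _ => by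
      simpa using (isHomogeneous_C (Fin m) (T (Pi.single j 1) i)).mul (isHomogeneous_X K j)
  simpa [pullback] using this

end Polynomials

end Algebra

theorem restrictToPlane_eq_pullback {K : Type*} [Field K] (H : Submodule K (Fin 4 → K))
    (e : H ≃ₗ[K] (Fin 3 → K)) (f : MvPolynomial (Fin 4) K) :
    restrictToPlane H e f = pullback (H.subtype ∘ₗ e.symm.toLinearMap) f := rfl

/-! ### Rational coordinates adapted to a line; points in no rational plane. -/

section Lines

variable {F : Type*} [Field F]

/-- Coordinates in which a line is given by the vanishing of the last two. -/
theorem exists_matrix_of_finrank_eq_two (L : Submodule F (Fin 4 → F))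
    (hL : Module.finrank F L = 2) : ∃ A : Matrix (Fin 4) (Fin 4) F,
      IsUnit A ∧ ∀ x, x ∈ L ↔ A.mulVec x 2 = 0 ∧ A.mulVec x 3 = 0 := by
  obtain ⟨C, hC⟩ := L.exists_isCompl
  have hC2 : Module.finrank F C = 2 := by
    have := Submodule.finrank_add_eq_of_isCompl hC
    rw [Module.finrank_fin_fun] at this
    omega
  let b : Module.Basis (Fin 4) F (Fin 4 → F) :=
    (((Module.finBasisOfFinrankEq F L hL).prod (Module.finBasisOfFinrankEq F C hC2)).map
      (L.prodEquivOfIsCompl C hC)).reindex finSumFinEquiv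
  have hb : ∀ x, (LinearMap.toMatrix' b.equivFun.toLinearMap).mulVec x = b.equivFun x := by
    intro x
    rw [LinearMap.toMatrix'_mulVec]
    rfl
  refine ⟨LinearMap.toMatrix' b.equivFun.toLinearMap, ?_, fun x => ?_⟩
  · rw [Matrix.isUnit_iff_isUnit_det, LinearMap.det_toMatrix']
    exact LinearEquiv.isUnit_det' _
  · rw [hb]
    have h : ∀ j : Fin 2, b.equivFun x (finSumFinEquiv (Sum.inr j)) =
        (Module.finBasisOfFinrankEq F C hC2).repr ((L.prodEquivOfIsCompl C hC).symm x).2 j := by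
      intro j
      simp [b]
    have h2 : b.equivFun x 2 = _ := h 0
    have h3 : b.equivFun x 3 = _ := h 1
    rw [h2, h3, ← Submodule.prodEquivOfIsCompl_symm_apply_snd_eq_zero _ _ hC,
      ← (Module.finBasisOfFinrankEq F C hC2).repr.map_eq_zero_iff, Finsupp.ext_iff,
      Fin.forall_fin_two]
    rfl

variable {K : Type*} [Field K] [Algebra F K]

theorem mulVec_inclusion (A : Matrix (Fin 4) (Fin 4) F) (x : Fin 4 → F) :
    (A.map (algebraMap F K)).mulVec (inclusion K x) = inclusion K (A.mulVec x) :=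
  (RingHom.map_mulVec (algebraMap F K) A x · |>.symm) |> funext

theorem isUnit_map {A : Matrix (Fin 4) (Fin 4) F} (hA : IsUnit A) :
    IsUnit (A.map (algebraMap F K)) :=
  hA.map (algebraMap F K).mapMatrix

/-- The first two columns of A⁻¹ are rational, lie in L, and span over K the solutions of the two
equations. -/
theorem mem_extendLine_iff {L : Submodule F (Fin 4 → F)} {A : Matrix (Fin 4) (Fin 4) F}
    (hA : IsUnit A) (hL : ∀ x, x ∈ L ↔ A.mulVec x 2 = 0 ∧ A.mulVec x 3 = 0) (v : Fin 4 → K) :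
    v ∈ extendLine K L ↔ (A.map (algebraMap F K)).mulVec v 2 = 0 ∧
      (A.map (algebraMap F K)).mulVec v 3 = 0 := by
  constructor
  · intro hv
    induction hv using Submodule.span_induction with
    | mem x hx =>
      obtain ⟨w, hw, rfl⟩ := hx
      rw [mulVec_inclusion]
      have := (hL w).1 hw
      simp [inclusion, this.1, this.2]
    | zero => simp
    | add x y _ _ hx hy => simp [Matrix.mulVec_add, hx.1, hx.2, hy.1, hy.2]
    | smul a x _ hx => simp [Matrix.mulVec_smul, hx.1, hx.2]
  · rintro ⟨h2, h3⟩
    obtain ⟨B, hAB⟩ := hA.exists_right_inv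
    have hmem : ∀ i : Fin 4, i ≠ 2 → i ≠ 3 →
        inclusion K (B.mulVec (Pi.single i 1)) ∈ extendLine K L := fun i hi2 hi3 => by
      refine Submodule.subset_span ⟨_, (hL _).2 ?_, rfl⟩
      rw [Matrix.mulVec_mulVec, hAB, Matrix.one_mulVec]
      simp [hi2.symm, hi3.symm]
    have hv : v = (A.map (algebraMap F K)).mulVec v 0 • inclusion K (B.mulVec (Pi.single 0 1)) +
        (A.map (algebraMap F K)).mulVec v 1 • inclusion K (B.mulVec (Pi.single 1 1)) := by
      refine Matrix.mulVec_injective_of_isUnit (isUnit_map (K := K) hA) ?_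
      rw [Matrix.mulVec_add, Matrix.mulVec_smul, Matrix.mulVec_smul, mulVec_inclusion,
        mulVec_inclusion, Matrix.mulVec_mulVec, Matrix.mulVec_mulVec, hAB, Matrix.one_mulVec,
        Matrix.one_mulVec]
      ext i
      fin_cases i <;> simp [inclusion, h2, h3]
    rw [hv]
    exact Submodule.add_mem _ (Submodule.smul_mem _ _ (hmem 0 (by decide) (by decide)))
      (Submodule.smul_mem _ _ (hmem 1 (by decide) (by decide)))

variable (F) in
/-- No nonzero linear form with coefficients in `F` vanishes at `p`. -/
def IsFree (p : Fin 4 → K) : Prop := ∀ c : Fin 4 → F, c ≠ 0 → inclusion K c ⬝ᵥ p ≠ 0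

/-- A rational change of coordinates permutes the rational linear forms, so any line may be put in
standard position. -/
theorem IsFree.mulVec {p : Fin 4 → K} (hp : IsFree F p) {A : Matrix (Fin 4) (Fin 4) F}
    (hA : IsUnit A) : IsFree F ((A.map (algebraMap F K)).mulVec p) := by
  intro c hc
  have h : Matrix.vecMul (inclusion K c) (A.map (algebraMap F K)) =
      inclusion K (Matrix.vecMul c A) :=
    funext fun i => (RingHom.map_vecMul (algebraMap F K) A c i).symm
  rw [Matrix.dotProduct_mulVec, h]
  refine hp _ fun h0 => hc (Matrix.vecMul_injective_of_isUnit hA ?_)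
  simpa using h0

theorem IsFree.apply_ne_zero {p : Fin 4 → K} (hp : IsFree F p) (i : Fin 4) : p i ≠ 0 := by
  have := hp (Pi.single i 1) (by simp)
  have h : inclusion K (Pi.single i (1 : F)) = Pi.single i 1 := by
    ext j
    by_cases hj : j = i
    · subst hj; simp [inclusion]
    · simp [inclusion, hj]
  rwa [h, single_dotProduct, one_mul] at this

theorem IsFree.mul_sub_mul_ne_zero {p : Fin 4 → K} (hp : IsFree F p) {a b : F}
    (h : a ≠ 0 ∨ b ≠ 0) :
    p 2 * algebraMap F K b - p 3 * algebraMap F K a ≠ 0 := by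
  have := hp ![0, 0, b, -a] (by
    rintro h0
    have h2 := congrFun h0 2
    have h3 := congrFun h0 3
    simp at h2 h3
    tauto)
  simp [dotProduct, Fin.sum_univ_four, inclusion] at this
  intro h0
  apply this
  linear_combination h0

/-- Otherwise (p₂, p₃) would be proportional to a rational pair, giving a rational linear relation
between them. -/
theorem IsFree.mul_pow_ne {p : Fin 4 → K} [Finite F] (hp : IsFree F p) :
    p 2 * p 3 ^ Nat.card F - p 2 ^ Nat.card F * p 3 ≠ 0 := by
  intro h
  obtain ⟨t, a, b, h2, h3⟩ := exists_smul_of_mul_pow_eq F (sub_eq_zero.1 h)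
  refine hp.mul_sub_mul_ne_zero (a := a) (b := b) ?_ (by rw [h2, h3]; ring)
  by_contra! hab
  exact hp.apply_ne_zero 2 (by simp [h2, hab.1])

end Lines

/-! ### The linear form of a join and the determinantal form. -/

section Forms

variable {K : Type*} [Field K]

/-- The linear form whose kernel is spanned by `p` and the line on which the last two coordinates
of `A x` vanish. -/
noncomputable def joinForm (A : Matrix (Fin 4) (Fin 4) K) (p : Fin 4 → K) :
    MvPolynomial (Fin 4) K :=
  ∑ j, C (A.mulVec p 2 * A 3 j - A.mulVec p 3 * A 2 j) * X j

theorem eval_joinForm (A : Matrix (Fin 4) (Fin 4) K) (p x : Fin 4 → K) :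
    eval x (joinForm A p) = A.mulVec p 2 * A.mulVec x 3 - A.mulVec p 3 * A.mulVec x 2 := by
  simp only [joinForm, map_sum, map_mul, eval_C, eval_X, Matrix.mulVec, dotProduct, sub_mul,
    Finset.sum_sub_distrib, Finset.mul_sum, mul_assoc]

theorem isHomogeneous_joinForm (A : Matrix (Fin 4) (Fin 4) K) (p : Fin 4 → K) :
    (joinForm A p).IsHomogeneous 1 :=
  IsHomogeneous.sum _ _ _ fun j _ => by
    simpa using (isHomogeneous_C (Fin 4) (A.mulVec p 2 * A 3 j - A.mulVec p 3 * A 2 j)).mul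
      (isHomogeneous_X K j)

theorem eval_joinForm_add_smul (A : Matrix (Fin 4) (Fin 4) K) (p x : Fin 4 → K) (t : K) :
    eval (x + t • p) (joinForm A p) = eval x (joinForm A p) := by
  simp only [eval_joinForm, Matrix.mulVec_add, Matrix.mulVec_smul, Pi.add_apply, Pi.smul_apply,
    smul_eq_mul]
  ring

theorem eval_detForm (q : ℕ) (p x : Fin 4 → K) : eval x (detForm q p) =
    Matrix.det (Matrix.of ![p, fun i => p i ^ q, x, fun i => x i ^ q]) := by
  rw [detForm, RingHom.map_det]
  congr 1
  ext i j
  fin_cases i <;> simp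

theorem isHomogeneous_detForm (q : ℕ) (p : Fin 4 → K) :
    (detForm q p).IsHomogeneous (q + 1) := by
  rw [detForm, Matrix.det_apply]
  refine IsHomogeneous.sum _ _ _ fun σ _ => ?_
  have h : (∏ i, Matrix.of ![fun i => C (p i), fun i => C (p i ^ q), fun i => X i,
      fun i => X i ^ q] (σ i) i : MvPolynomial (Fin 4) K).IsHomogeneous (q + 1) := by
    rw [← Equiv.prod_comp σ.symm]
    simp only [Equiv.apply_symm_apply, Fin.prod_univ_four]
    have := (((isHomogeneous_C (Fin 4) (p (σ.symm 0))).mul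
      (isHomogeneous_C (Fin 4) (p (σ.symm 1) ^ q))).mul (isHomogeneous_X K (σ.symm 2))).mul
      (isHomogeneous_X_pow (R := K) (σ.symm 3) q)
    simpa [add_comm] using this
  exact (homogeneousSubmodule (Fin 4) K (q + 1)).smul_of_tower_mem (Equiv.Perm.sign σ) h

variable {F : Type*} [Field F] [Finite F] [Algebra F K]

/-- As the q-power map is additive, the change adds t times row one to row three and t^q times row
two to row four. -/
theorem eval_detForm_add_smul (p x : Fin 4 → K) (t : K) :
    eval (x + t • p) (detForm (Nat.card F) p) = eval x (detForm (Nat.card F) p) := by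
  simp only [eval_detForm, Pi.add_apply, Pi.smul_apply, smul_eq_mul, add_pow_natCard F, mul_pow]
  simp [Matrix.det_succ_row_zero, Fin.sum_univ_succ, Fin.succAbove]
  ring

/-- The entries of A are fixed by the q-power map, so A acts on all four rows alike. -/
theorem eval_detForm_mulVec (A : Matrix (Fin 4) (Fin 4) F) (p x : Fin 4 → K) :
    eval ((A.map (algebraMap F K)).mulVec x)
      (detForm (Nat.card F) ((A.map (algebraMap F K)).mulVec p)) =
    (A.map (algebraMap F K)).det * eval x (detForm (Nat.card F) p) := by
  have h : ∀ (v : Fin 4 → K) (i : Fin 4), (A.map (algebraMap F K)).mulVec v i ^ Nat.card F =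
      (A.map (algebraMap F K)).mulVec (fun j => v j ^ Nat.card F) i := fun v i => by
    simp [Matrix.mulVec, dotProduct, sum_pow_natCard F, mul_pow, algebraMap_pow_natCard]
  simp only [eval_detForm, h]
  rw [mul_comm, ← Matrix.det_transpose (A.map _), ← Matrix.det_mul]
  congr 1
  ext i j
  fin_cases i <;> simp [Matrix.mul_apply, Matrix.mulVec, dotProduct, mul_comm]

/-- The lower right 2 × 2 block vanishes, so the determinant is a product of two minors; `hq`
ensures 0^q = 0. -/
theorem eval_detForm_of_apply_eq_zero {q : ℕ} (hq : q ≠ 0) (p x : Fin 4 → K) (h2 : x 2 = 0)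
    (h3 : x 3 = 0) : eval x (detForm q p) =
      (p 2 * p 3 ^ q - p 2 ^ q * p 3) * (x 0 * x 1 ^ q - x 0 ^ q * x 1) := by
  rw [eval_detForm]
  simp [Matrix.det_succ_row_zero, Fin.sum_univ_succ, Fin.succAbove, h2, h3, hq]
  ring

end Forms

/-! ### The ideal of the projected rational points of one line. -/

section Plane

variable {F : Type*} [Field F] {K : Type*} [Field K] [Algebra F K]

/-- The ideal of the images under `φ` of the rational points of the line `L`. -/
def lineIdeal (φ : (Fin 4 → K) →ₗ[K] (Fin 3 → K)) (L : Submodule F (Fin 4 → F)) :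
    Ideal (MvPolynomial (Fin 3) K) :=
  vanishingIdeal K {v | ∃ w ∈ L, w ≠ 0 ∧ ∃ t : K, t ≠ 0 ∧ v = t • φ (inclusion K w)}

theorem mem_lineIdeal {φ : (Fin 4 → K) →ₗ[K] (Fin 3 → K)} {L : Submodule F (Fin 4 → F)}
    {f : MvPolynomial (Fin 3) K} : f ∈ lineIdeal φ L ↔
      ∀ w ∈ L, w ≠ 0 → ∀ t : K, t ≠ 0 → eval (t • φ (inclusion K w)) f = 0 := by
  constructor
  · exact fun h w hw hw0 t ht => h _ ⟨w, hw, hw0, t, ht, rfl⟩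
  · rintro h _ ⟨w, hw, hw0, t, ht, rfl⟩
    exact h w hw hw0 t ht

variable {φ : (Fin 4 → K) →ₗ[K] (Fin 3 → K)} {σ : (Fin 3 → K) →ₗ[K] (Fin 4 → K)}
  {p : Fin 4 → K}

/-- Here φ is the projection and σ the inclusion of the plane; `hσφ` says that σ ∘ φ moves vectors
only along p, which the form does not notice. -/
theorem eval_pullback_joinForm (hσφ : ∀ x, ∃ t : K, σ (φ x) = x + t • p)
    (A : Matrix (Fin 4) (Fin 4) K) (x : Fin 4 → K) :
    eval (φ x) (pullback σ (joinForm A p)) = eval x (joinForm A p) := by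
  obtain ⟨t, ht⟩ := hσφ x
  rw [eval_pullback, ht, eval_joinForm_add_smul]

theorem eval_pullback_detForm [Finite F] (hσφ : ∀ x, ∃ t : K, σ (φ x) = x + t • p)
    (x : Fin 4 → K) : eval (φ x) (pullback σ (detForm (Nat.card F) p)) =
      eval x (detForm (Nat.card F) p) := by
  obtain ⟨t, ht⟩ := hσφ x
  rw [eval_pullback, ht, eval_detForm_add_smul]

variable {L : Submodule F (Fin 4 → F)} {A : Matrix (Fin 4) (Fin 4) F}

theorem pullback_joinForm_mem_lineIdeal (hσφ : ∀ x, ∃ t : K, σ (φ x) = x + t • p)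
    (hL : ∀ x, x ∈ L ↔ A.mulVec x 2 = 0 ∧ A.mulVec x 3 = 0) :
    pullback σ (joinForm (A.map (algebraMap F K)) p) ∈ lineIdeal φ L := by
  refine mem_lineIdeal.2 fun w hw _ t _ => ?_
  have h := (hL w).1 hw
  rw [← map_smul, eval_pullback_joinForm hσφ, eval_joinForm, Matrix.mulVec_smul, mulVec_inclusion]
  simp [inclusion, h.1, h.2]

theorem exists_mul_eval_detForm_eq [Finite F] (hA : IsUnit A) (hp : IsFree F p) :
    ∃ c : K, c ≠ 0 ∧ ∀ x, (A.map (algebraMap F K)).mulVec x 2 = 0 →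
      (A.map (algebraMap F K)).mulVec x 3 = 0 → c * eval x (detForm (Nat.card F) p) =
      (A.map (algebraMap F K)).mulVec x 0 * (A.map (algebraMap F K)).mulVec x 1 ^ Nat.card F -
      (A.map (algebraMap F K)).mulVec x 0 ^ Nat.card F * (A.map (algebraMap F K)).mulVec x 1 := by
  have hd : (A.map (algebraMap F K)).det ≠ 0 :=
    ((Matrix.isUnit_iff_isUnit_det _).1 (isUnit_map (K := K) hA)).ne_zero
  have hN := (hp.mulVec hA).mul_pow_ne
  refine ⟨_, div_ne_zero hd hN, fun x h2 h3 => ?_⟩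
  have h := eval_detForm_mulVec A p x
  rw [eval_detForm_of_apply_eq_zero Nat.card_pos.ne' _ _ h2 h3] at h
  rw [div_mul_eq_mul_div, ← h, mul_div_cancel_left₀ _ hN]

theorem pullback_detForm_mem_lineIdeal [Finite F] (hσφ : ∀ x, ∃ t : K, σ (φ x) = x + t • p)
    (hp : IsFree F p) (hA : IsUnit A) (hL : ∀ x, x ∈ L ↔ A.mulVec x 2 = 0 ∧ A.mulVec x 3 = 0) :
    pullback σ (detForm (Nat.card F) p) ∈ lineIdeal φ L := by
  refine mem_lineIdeal.2 fun w hw _ t _ => ?_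
  obtain ⟨c, hc, h⟩ := exists_mul_eval_detForm_eq (K := K) hA hp
  have hwL := (hL w).1 hw
  rw [← map_smul, eval_pullback_detForm hσφ]
  refine (mul_eq_zero.1 ?_).resolve_left hc
  rw [h] <;> rw [Matrix.mulVec_smul, mulVec_inclusion]
  -- The coordinates are ta and tb with a, b fixed by the q-power map, so the two products cancel.
  · simp only [inclusion, LinearMap.coe_mk, AddHom.coe_mk, Pi.smul_apply, smul_eq_mul, mul_pow,
      algebraMap_pow_natCard]
    ring
  · simp [inclusion, hwL.1]
  · simp [inclusion, hwL.2]

theorem isHomogeneous_pullback_joinForm (A : Matrix (Fin 4) (Fin 4) K) :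
    (pullback σ (joinForm A p)).IsHomogeneous 1 :=
  isHomogeneous_pullback σ (isHomogeneous_joinForm A p)

theorem exists_mulVec_eq (hA : IsUnit A) (y : Fin 4 → K) :
    ∃ x, (A.map (algebraMap F K)).mulVec x = y := by
  obtain ⟨B, hB⟩ := (isUnit_map (K := K) hA).exists_right_inv
  exact ⟨B.mulVec y, by rw [Matrix.mulVec_mulVec, hB, Matrix.one_mulVec]⟩

theorem joinForm_ne_zero (hp : IsFree F p) (hA : IsUnit A) :
    joinForm (A.map (algebraMap F K)) p ≠ 0 := by
  intro h0
  obtain ⟨x, hx⟩ := exists_mulVec_eq (K := K) hA (Pi.single 3 1)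
  have h := eval_joinForm (A.map (algebraMap F K)) p x
  rw [h0, hx] at h
  simp only [map_zero, Pi.single_eq_same, mul_one, ne_eq, Fin.reduceEq, not_false_eq_true,
    Pi.single_eq_of_ne, mul_zero, sub_zero] at h
  exact (hp.mulVec hA).apply_ne_zero 2 h.symm

theorem irreducible_pullback_joinForm (hσφ : ∀ x, ∃ t : K, σ (φ x) = x + t • p)
    (hp : IsFree F p) (hA : IsUnit A) :
    Irreducible (pullback σ (joinForm (A.map (algebraMap F K)) p)) := by
  refine irreducible_of_isHomogeneous_one (isHomogeneous_pullback_joinForm _) fun h0 => ?_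
  obtain ⟨x, hx⟩ := exists_mulVec_eq (K := K) hA (Pi.single 3 1)
  have h := eval_pullback_joinForm hσφ (A.map (algebraMap F K)) x
  rw [h0, eval_joinForm, hx] at h
  simp only [map_zero, Pi.single_eq_same, mul_one, ne_eq, Fin.reduceEq, not_false_eq_true,
    Pi.single_eq_of_ne, mul_zero, sub_zero] at h
  exact (hp.mulVec hA).apply_ne_zero 2 h.symm

/-- This regularity is where skewness of the lines enters. -/
theorem mem_lineIdeal_of_pullback_joinForm_mul_mem (hσφ : ∀ x, ∃ t : K, σ (φ x) = x + t • p)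
    (hp : IsFree F p) (hA : IsUnit A) (hL : ∀ x, x ∈ L ↔ A.mulVec x 2 = 0 ∧ A.mulVec x 3 = 0)
    {L' : Submodule F (Fin 4 → F)} (hLL' : Disjoint L L') {f : MvPolynomial (Fin 3) K}
    (hf : pullback σ (joinForm (A.map (algebraMap F K)) p) * f ∈ lineIdeal φ L') :
    f ∈ lineIdeal φ L' := by
  refine mem_lineIdeal.2 fun w hw hw0 t ht => ?_
  have h := mem_lineIdeal.1 hf w hw hw0 t ht
  rw [map_mul] at h
  refine (mul_eq_zero.1 h).resolve_left fun h0 => ?_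
  have hwL : w ∉ L := fun hwL => hw0 (Submodule.disjoint_def.1 hLL' w hwL hw)
  rw [hL] at hwL
  refine (hp.mulVec hA).mul_sub_mul_ne_zero (a := A.mulVec w 2) (b := A.mulVec w 3) (by tauto) ?_
  rw [← map_smul, eval_pullback_joinForm hσφ, eval_joinForm, Matrix.mulVec_smul,
    mulVec_inclusion] at h0
  refine (mul_eq_zero.1 (?_ : t * _ = 0)).resolve_left ht
  simp only [inclusion, LinearMap.coe_mk, AddHom.coe_mk, Pi.smul_apply, smul_eq_mul] at h0
  linear_combination h0

variable [Infinite K]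

theorem exists_mul_pow_sub_ne_zero {q : ℕ} (hq : 1 < q) :
    ∃ a : K, 1 * a ^ q - 1 ^ q * a ≠ 0 := by
  by_contra! h
  refine FiniteField.X_pow_card_sub_X_ne_zero K hq (Polynomial.funext fun a => ?_)
  simpa using h a

/-- The point of the extended line with coordinates (1, a), a^q ≠ a, is a zero of the linear form
but not of the determinant. -/
theorem not_pullback_joinForm_dvd_pullback_detForm [Finite F]
    (hσφ : ∀ x, ∃ t : K, σ (φ x) = x + t • p) (hp : IsFree F p) (hA : IsUnit A) :
    ¬ pullback σ (joinForm (A.map (algebraMap F K)) p) ∣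
      pullback σ (detForm (Nat.card F) p) := by
  rintro ⟨g, hg⟩
  obtain ⟨a, ha⟩ := exists_mul_pow_sub_ne_zero (K := K) (Finite.one_lt_card (α := F))
  obtain ⟨x, hx⟩ := exists_mulVec_eq (K := K) hA ![1, a, 0, 0]
  obtain ⟨c, -, h⟩ := exists_mul_eval_detForm_eq (K := K) hA hp
  refine ha ?_
  have h1 := h x (by simp [hx]) (by simp [hx])
  have h2 := eval_pullback_detForm (F := F) hσφ x
  rw [hg, map_mul, eval_pullback_joinForm hσφ, eval_joinForm] at h2
  rw [← h2] at h1
  simpa [hx] using h1.symm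

theorem detForm_ne_zero [Finite F] (hp : IsFree F p) : detForm (Nat.card F) p ≠ 0 := by
  intro h0
  obtain ⟨a, ha⟩ := exists_mul_pow_sub_ne_zero (K := K) (Finite.one_lt_card (α := F))
  obtain ⟨x, hx⟩ := exists_mulVec_eq (K := K) (isUnit_one (M := Matrix (Fin 4) (Fin 4) F))
    ![1, a, 0, 0]
  obtain ⟨c, -, h⟩ := exists_mul_eval_detForm_eq (K := K) isUnit_one hp
  have h1 := h x (by rw [hx]; simp) (by rw [hx]; simp)
  rw [hx, h0] at h1
  exact ha (by simpa using h1.symm)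

theorem pullback_detForm_ne_zero [Finite F] (hσφ : ∀ x, ∃ t : K, σ (φ x) = x + t • p)
    (hp : IsFree F p) : pullback σ (detForm (Nat.card F) p) ≠ 0 := by
  intro h0
  refine detForm_ne_zero hp (MvPolynomial.funext fun x => ?_)
  rw [← eval_pullback_detForm hσφ, h0, map_zero, map_zero]

/-- Restricted to the projected line, f is divisible by x₀x₁^q - x₀^q x₁, that is, by the restricted
determinant. Lifting the quotient to the plane and subtracting leaves a polynomial vanishing on the
line, a multiple of its linear form. -/
theorem lineIdeal_le [IsAlgClosed K] [Finite F] (hφσ : ∀ y, φ (σ y) = y) (hφp : φ p = 0)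
    (hp : IsFree F p) (hA : IsUnit A) (hL : ∀ x, x ∈ L ↔ A.mulVec x 2 = 0 ∧ A.mulVec x 3 = 0)
    (hσφ : ∀ x, ∃ t : K, σ (φ x) = x + t • p) :
    lineIdeal φ L ≤ Ideal.span {pullback σ (joinForm (A.map (algebraMap F K)) p),
      pullback σ (detForm (Nat.card F) p)} := by
  intro f hf
  rw [mem_lineIdeal] at hf
  set A' := A.map (algebraMap F K) with hA'
  set p' := A'.mulVec p with hp'
  have hp2 : p' 2 ≠ 0 := (hp.mulVec hA).apply_ne_zero 2
  obtain ⟨B, hAB⟩ := hA.exists_right_inv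
  have hBmem : ∀ a b : F, B.mulVec ![a, b, 0, 0] ∈ L := fun a b => by
    rw [hL, Matrix.mulVec_mulVec, hAB, Matrix.one_mulVec]
    simp
  -- A parametrization of the extended line L by K².
  let τ : (Fin 2 → K) →ₗ[K] (Fin 4 → K) := (B.map (algebraMap F K)).mulVecLin ∘ₗ
    LinearMap.pi ![LinearMap.proj 0, LinearMap.proj 1, 0, 0]
  have hτ : ∀ y, τ y = (B.map (algebraMap F K)).mulVec ![y 0, y 1, 0, 0] := by
    intro y
    simp only [τ, LinearMap.comp_apply, Matrix.mulVecLin_apply]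
    congr 1
    ext i
    fin_cases i <;> simp
  have hA'τ : ∀ y, A'.mulVec (τ y) = ![y 0, y 1, 0, 0] := by
    intro y
    rw [hτ, Matrix.mulVec_mulVec, hA', ← Matrix.map_mul, hAB]
    simp
  let ρ : (Fin 3 → K) →ₗ[K] (Fin 4 → K) := A'.mulVecLin ∘ₗ σ
  -- A linear map inverting φ ∘ τ on the projected line: subtract the multiple of p that kills
  -- coordinate 2, then keep coordinates 0 and 1. Coordinate 3 dies as well exactly when the linear
  -- form vanishes.
  let π : (Fin 3 → K) →ₗ[K] (Fin 2 → K) := LinearMap.pi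
    ![LinearMap.proj 0 ∘ₗ ρ - (p' 0 / p' 2) • (LinearMap.proj 2 ∘ₗ ρ),
      LinearMap.proj 1 ∘ₗ ρ - (p' 1 / p' 2) • (LinearMap.proj 2 ∘ₗ ρ)]
  have hτπ : ∀ y, eval y (pullback σ (joinForm A' p)) = 0 →
      σ y = τ (π y) + (A'.mulVec (σ y) 2 / p' 2) • p := by
    intro y hy
    rw [eval_pullback, eval_joinForm] at hy
    refine Matrix.mulVec_injective_of_isUnit (isUnit_map (K := K) hA) ?_
    change A'.mulVec _ = A'.mulVec _
    rw [Matrix.mulVec_add, hA'τ, Matrix.mulVec_smul, ← hp']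
    ext i
    fin_cases i
    · simp [π, ρ]
      field_simp
      ring
    · simp [π, ρ]
      field_simp
      ring
    · simp [hp2]
    · simp
      field_simp
      linear_combination hy
  obtain ⟨h, hh⟩ : (X 0 * X 1 ^ Nat.card F - X 0 ^ Nat.card F * X 1 : MvPolynomial (Fin 2) K) ∣
      pullback (φ ∘ₗ τ) f := by
    refine dvd_of_squarefree_of_eval_eq_zero (squarefree_X_mul_X_pow_sub
      (cast_natCard_eq_zero F)) fun y hy => ?_
    obtain ⟨t, a, b, h0, h1⟩ := exists_smul_of_mul_pow_eq F (α := y 0) (β := y 1) (by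
      simpa [sub_eq_zero] using hy)
    have hy' : τ y = t • inclusion K (B.mulVec ![a, b, 0, 0]) := by
      rw [← mulVec_inclusion, ← Matrix.mulVec_smul, hτ]
      congr 1
      ext i
      fin_cases i <;> simp [inclusion, h0, h1]
    rw [eval_pullback, LinearMap.comp_apply, hy', map_smul]
    -- Here the vector is the origin, which `hf` does not cover; it is reached along the rational
    -- vector with coordinates (1, 0).
    by_cases hz : t = 0 ∨ B.mulVec ![a, b, 0, 0] = 0
    · have hz' : t • φ (inclusion K (B.mulVec ![a, b, 0, 0])) = 0 := by
        rcases hz with hz | hz <;> simp [hz]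
      rw [hz']
      refine eval_zero_eq_zero_of_eval_smul f _ (hf _ (hBmem 1 0) fun h0 => ?_)
      have := congrArg (A.mulVec · 0) h0
      simp [Matrix.mulVec_mulVec, hAB] at this
    · push Not at hz
      exact hf _ (hBmem a b) hz.2 t hz.1
  obtain ⟨c, -, hc⟩ := exists_mul_eval_detForm_eq (K := K) hA hp
  obtain ⟨g, hg⟩ : pullback σ (joinForm A' p) ∣
      f - C c * pullback σ (detForm (Nat.card F) p) * pullback π h := by
    refine dvd_of_squarefree_of_eval_eq_zero
      (irreducible_pullback_joinForm hσφ hp hA).squarefree fun y hy => ?_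
    have hσy := hτπ y hy
    have hy' : φ (τ (π y)) = y := by
      conv_rhs => rw [← hφσ y, hσy, map_add, map_smul, hφp, smul_zero, add_zero]
    have h1 := congrArg (eval (π y)) hh
    rw [eval_pullback, LinearMap.comp_apply, hy'] at h1
    have h2 := hc (τ (π y)) (by rw [← hA', hA'τ]; simp) (by rw [← hA', hA'τ]; simp)
    rw [← hA', hA'τ] at h2
    have h3 : eval y (pullback σ (detForm (Nat.card F) p)) =
        eval (τ (π y)) (detForm (Nat.card F) p) := by
      rw [eval_pullback, hσy, eval_detForm_add_smul]
    simp only [map_sub, map_mul, eval_C, h3, eval_pullback, h1]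
    rw [h2]
    simp
  rw [Ideal.mem_span_pair]
  exact ⟨g, C c * pullback π h, by linear_combination -hg⟩

end Plane

/-! ### From one line to the whole partial spread. -/

section Projection

variable {F : Type*} [Field F] {K : Type*} [Field K] [Algebra F K]

theorem mem_pointsOf {S : Finset (Submodule F (Fin 4 → F))} {Q : ℙ K (Fin 4 → K)} :
    Q ∈ pointsOf K S ↔ ∃ L ∈ S, ∃ w ∈ L, w ≠ 0 ∧ Q.submodule = K ∙ inclusion K w := by
  constructor
  · rintro ⟨z, ⟨L, hL, hzL⟩, rfl⟩
    induction z using Projectivization.ind with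
    | h w hw =>
      rw [Projectivization.submodule_mk, Submodule.span_singleton_le_iff_mem] at hzL
      refine ⟨L, hL, w, hzL, hw, ?_⟩
      rw [includePoint, Projectivization.map_mk, Projectivization.submodule_mk]
  · rintro ⟨L, hL, w, hw, hw0, hQ⟩
    refine ⟨Projectivization.mk F w hw0, ⟨L, hL, ?_⟩, ?_⟩
    · rwa [Projectivization.submodule_mk, Submodule.span_singleton_le_iff_mem]
    · refine Projectivization.submodule_injective ?_
      rw [hQ, includePoint, Projectivization.map_mk, Projectivization.submodule_mk]

theorem finite_pointsOf [Finite F] (S : Finset (Submodule F (Fin 4 → F))) :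
    (pointsOf K S).Finite := by
  have : Finite (ℙ F (Fin 4 → F)) := Quotient.finite _
  exact (Set.toFinite _).image _

/-- If w were a multiple of p, then w₁x₀ - w₀x₁ would be a nonzero rational form vanishing at p. -/
theorem IsFree.inclusion_ne_smul {p : Fin 4 → K} (hp : IsFree F p) {w : Fin 4 → F} (hw : w ≠ 0)
    (t : K) : inclusion K w ≠ t • p := by
  intro h
  have hi : ∀ i, algebraMap F K (w i) = t * p i := fun i => congrFun h i
  have ht : t ≠ 0 := by
    rintro rfl
    exact hw (funext fun i => by simpa using hi i)
  have h0 : w 0 ≠ 0 := fun h0 => by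
    have := hi 0
    simp [h0, ht, hp.apply_ne_zero 0] at this
  refine hp ![w 1, -w 0, 0, 0] (fun hc => h0 (by simpa using congrFun hc 1)) ?_
  simp [dotProduct, Fin.sum_univ_four, inclusion, hi]
  ring

theorem IsFree.notMem_pointsOf {P : ℙ K (Fin 4 → K)} (hP : IsFree F P.rep)
    (S : Finset (Submodule F (Fin 4 → F))) : P ∉ pointsOf K S := by
  intro h
  obtain ⟨L, -, w, -, hw0, h⟩ := mem_pointsOf.1 h
  have hw : inclusion K w ∈ P.submodule := h ▸ Submodule.mem_span_singleton_self _
  rw [Projectivization.submodule_eq, Submodule.mem_span_singleton] at hw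
  obtain ⟨t, ht⟩ := hw
  exact hP.inclusion_ne_smul hw0 t ht.symm

variable {φ : (Fin 4 → K) →ₗ[K] (Fin 3 → K)} {σ : (Fin 3 → K) →ₗ[K] (Fin 4 → K)}
  {p : Fin 4 → K}

theorem mem_homogeneousIdeal_imageUnder_iff (hσφ : ∀ x, ∃ t : K, σ (φ x) = x + t • p)
    (hp : IsFree F p) (S : Finset (Submodule F (Fin 4 → F))) (f : MvPolynomial (Fin 3) K) :
    f ∈ homogeneousIdeal (imageUnder φ (pointsOf K S)) ↔ ∀ L ∈ S, f ∈ lineIdeal φ L := by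
  -- No rational point is dropped by the projection.
  have hφ : ∀ w : Fin 4 → F, w ≠ 0 → φ (inclusion K w) ≠ 0 := fun w hw h => by
    obtain ⟨t, ht⟩ := hσφ (inclusion K w)
    rw [h, map_zero] at ht
    exact hp.inclusion_ne_smul hw (-t) (by rw [neg_smul]; exact eq_neg_of_add_eq_zero_left ht.symm)
  simp only [mem_lineIdeal]
  constructor
  · intro hf L hL w hw hw0 t ht
    have hv : t • φ (inclusion K w) ≠ 0 := smul_ne_zero ht (hφ w hw0)
    refine hf _ ⟨hv, Projectivization.mk K (inclusion K w) fun h => hφ w hw0 (by simp [h]),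
      mem_pointsOf.2 ⟨L, hL, w, hw, hw0, Projectivization.submodule_mk ..⟩, ?_⟩
    rw [Projectivization.submodule_mk, Projectivization.submodule_mk, Submodule.map_span,
      Set.image_singleton, Submodule.span_singleton_smul_eq (IsUnit.mk0 t ht)]
  · rintro hf v ⟨hv, z, hz, hvz⟩
    obtain ⟨L, hL, w, hw, hw0, hzw⟩ := mem_pointsOf.1 hz
    rw [Projectivization.submodule_mk, hzw, Submodule.map_span, Set.image_singleton] at hvz
    have hmem : v ∈ K ∙ φ (inclusion K w) := hvz ▸ Submodule.mem_span_singleton_self v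
    obtain ⟨t, rfl⟩ := Submodule.mem_span_singleton.1 hmem
    exact hf L hL w hw hw0 t fun ht => hv (by simp [ht])

theorem isCompleteIntersectionOf_projection [Finite F] [IsAlgClosed K] (hφσ : ∀ y, φ (σ y) = y)
    (hφp : φ p = 0) (hσφ : ∀ x, ∃ t : K, σ (φ x) = x + t • p) (hp : IsFree F p)
    (S : Finset (Submodule F (Fin 4 → F)))
    (hS : ∀ L ∈ S, ∀ L' ∈ S, L ≠ L' → Disjoint L L')
    (A : Submodule F (Fin 4 → F) → Matrix (Fin 4) (Fin 4) F) (hA : ∀ L ∈ S, IsUnit (A L))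
    (hL : ∀ L ∈ S, ∀ x, x ∈ L ↔ (A L).mulVec x 2 = 0 ∧ (A L).mulVec x 3 = 0) :
    IsCompleteIntersectionOf (imageUnder φ (pointsOf K S)) S.card (Nat.card F + 1)
      (pullback σ (∏ L ∈ S, joinForm ((A L).map (algebraMap F K)) p))
      (pullback σ (detForm (Nat.card F) p)) := by
  classical
  rw [map_prod]
  have hirr := fun L hLS => irreducible_pullback_joinForm hσφ hp (hA L hLS)
  refine ⟨Finset.prod_ne_zero_iff.2 fun L hLS => (hirr L hLS).ne_zero, ?_,
    pullback_detForm_ne_zero hσφ hp, isHomogeneous_pullback σ (isHomogeneous_detForm _ _), ?_, ?_⟩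
  · simpa using IsHomogeneous.prod S _ (fun _ => 1)
      fun L _ => isHomogeneous_pullback_joinForm ((A L).map (algebraMap F K))
  · exact IsRelPrime.prod_left fun L hLS => (hirr L hLS).isRelPrime_iff_not_dvd.2
      (not_pullback_joinForm_dvd_pullback_detForm hσφ hp (hA L hLS))
  · refine le_antisymm (fun f hf => ?_) (Ideal.span_le.2 ?_)
    · rw [mem_homogeneousIdeal_imageUnder_iff hσφ hp] at hf
      exact mem_span_prod_pair S (lineIdeal φ) _ _
        (fun L hLS => lineIdeal_le hφσ hφp hp (hA L hLS) (hL L hLS) hσφ)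
        (fun L hLS => pullback_detForm_mem_lineIdeal hσφ hp (hA L hLS) (hL L hLS))
        (fun L hLS L' hLS' hne f hf => mem_lineIdeal_of_pullback_joinForm_mul_mem hσφ hp
          (hA L hLS) (hL L hLS) (hS L hLS L' hLS' hne) hf) hf
    · rintro f (rfl | rfl)
      · refine (mem_homogeneousIdeal_imageUnder_iff hσφ hp S _).2 fun L hLS => ?_
        exact Ideal.mem_of_dvd _ (Finset.dvd_prod_of_mem _ hLS)
          (pullback_joinForm_mem_lineIdeal hσφ (hL L hLS))
      · exact (mem_homogeneousIdeal_imageUnder_iff hσφ hp S _).2 fun L hLS =>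
          pullback_detForm_mem_lineIdeal hσφ hp (hA L hLS) (hL L hLS)

theorem exists_projectionFrom_apply (P : ℙ K (Fin 4 → K)) (H : Submodule K (Fin 4 → K))
    (h : IsCompl H P.submodule) (e : H ≃ₗ[K] (Fin 3 → K)) (x : Fin 4 → K) :
    ∃ t : K, (H.subtype ∘ₗ e.symm.toLinearMap) (projectionFrom P H h e x) = x + t • P.rep := by
  have hmem : x - (H.projectionOnto P.submodule h x : Fin 4 → K) ∈ P.submodule := by
    rw [← Submodule.projectionOnto_apply_eq_zero_iff h, map_sub,
      Submodule.projectionOnto_apply_left, sub_self]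
  obtain ⟨t, ht⟩ := Submodule.mem_span_singleton.1 (P.submodule_eq.le hmem)
  refine ⟨-t, ?_⟩
  rw [neg_smul, ht]
  simp [projectionFrom, -Submodule.coe_projectionOnto_apply]

theorem projectionFrom_apply_symm (P : ℙ K (Fin 4 → K)) (H : Submodule K (Fin 4 → K))
    (h : IsCompl H P.submodule) (e : H ≃ₗ[K] (Fin 3 → K)) (y : Fin 3 → K) :
    projectionFrom P H h e ((H.subtype ∘ₗ e.symm.toLinearMap) y) = y := by
  simp [projectionFrom]

theorem projectionFrom_rep (P : ℙ K (Fin 4 → K)) (H : Submodule K (Fin 4 → K))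
    (h : IsCompl H P.submodule) (e : H ≃ₗ[K] (Fin 3 → K)) :
    projectionFrom P H h e P.rep = 0 := by
  have : P.rep ∈ P.submodule := by
    rw [Projectivization.submodule_eq]
    exact Submodule.mem_span_singleton_self _
  simp [projectionFrom, (Submodule.projectionOnto_apply_eq_zero_iff h).2 this]

end Projection

/-! ### Multiplicity at the vertex and the zero set of G. -/

section Cones

variable {F : Type*} [Field F] {K : Type*} [Field K] [Algebra F K]

theorem mem_homogeneousIdeal_singleton {n : ℕ} {P : ℙ K (Fin n → K)}
    {f : MvPolynomial (Fin n) K} (hf : ∀ t : K, eval (t • P.rep) f = 0) :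
    f ∈ homogeneousIdeal {P} := by
  rintro v ⟨hv, hvP⟩
  rw [Set.mem_singleton_iff] at hvP
  obtain ⟨a, ha⟩ := Projectivization.exists_smul_eq_mk_rep K v hv
  rw [hvP] at ha
  have h := hf ((a⁻¹ : Kˣ) : K)
  rw [← ha, Units.smul_def, smul_smul, Units.inv_mul, one_smul] at h
  exact h

theorem isConeWithVertex_prod_joinForm {P : ℙ K (Fin 4 → K)} (hP : IsFree F P.rep)
    (S : Finset (Submodule F (Fin 4 → F)))
    (A : Submodule F (Fin 4 → F) → Matrix (Fin 4) (Fin 4) F) (hA : ∀ L ∈ S, IsUnit (A L)) :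
    IsConeWithVertex P S.card (∏ L ∈ S, joinForm ((A L).map (algebraMap F K)) P.rep) := by
  refine ⟨Finset.prod_ne_zero_iff.2 fun L hL => joinForm_ne_zero hP (hA L hL), ?_, ?_⟩
  · simpa using IsHomogeneous.prod S _ (fun _ => 1)
      fun L _ => isHomogeneous_joinForm ((A L).map (algebraMap F K)) P.rep
  · rw [← Finset.prod_const]
    refine Ideal.prod_mem_prod fun L _ => mem_homogeneousIdeal_singleton fun t => ?_
    rw [eval_joinForm, Matrix.mulVec_smul]
    simp
    ring

theorem zeroSet_prod_joinForm {P : ℙ K (Fin 4 → K)} (hP : IsFree F P.rep)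
    (S : Finset (Submodule F (Fin 4 → F)))
    (A : Submodule F (Fin 4 → F) → Matrix (Fin 4) (Fin 4) F) (hA : ∀ L ∈ S, IsUnit (A L))
    (hL : ∀ L ∈ S, ∀ x, x ∈ L ↔ (A L).mulVec x 2 = 0 ∧ (A L).mulVec x 3 = 0) :
    zeroSet (∏ L ∈ S, joinForm ((A L).map (algebraMap F K)) P.rep) = join K S P := by
  ext Q
  simp only [zeroSet, join, Set.mem_ofPred_eq, map_prod, Finset.prod_eq_zero_iff]
  refine exists_congr fun L => and_congr_right fun hLS => ?_
  have h2 := (hP.mulVec (hA L hLS)).apply_ne_zero 2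
  rw [Projectivization.submodule_eq, Projectivization.submodule_eq,
    Submodule.span_singleton_le_iff_mem, Submodule.mem_sup, eval_joinForm]
  simp only [Submodule.mem_span_singleton, mem_extendLine_iff (hA L hLS) (hL L hLS)]
  constructor
  · intro h
    -- With this c, Q - cP has coordinate 2 equal to zero; the vanishing of the linear form then
    -- kills coordinate 3.
    set c := ((A L).map (algebraMap F K)).mulVec Q.rep 2 /
      ((A L).map (algebraMap F K)).mulVec P.rep 2 with hc
    refine ⟨c • P.rep, ⟨c, rfl⟩, Q.rep - c • P.rep, ⟨?_, ?_⟩, by abel⟩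
    · rw [Matrix.mulVec_sub, Matrix.mulVec_smul]
      simp [hc, h2]
    · rw [Matrix.mulVec_sub, Matrix.mulVec_smul]
      simp only [Pi.sub_apply, Pi.smul_apply, smul_eq_mul, hc]
      field_simp
      linear_combination h
  · rintro ⟨_, ⟨t, rfl⟩, z, ⟨hz2, hz3⟩, hQ⟩
    rw [← hQ, Matrix.mulVec_add, Matrix.mulVec_smul]
    simp [hz2, hz3]
    ring

variable [Finite F]

/-- The row operations of `eval_detForm_add_smul`, done over the polynomial ring with t = X_i / p_i,
replace X_j by X_j - t p_j, which vanishes at P. Each term of the determinant then has q + 1 such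
factors: one from row three and q from row four. -/
theorem detForm_mem_homogeneousIdeal_pow {P : ℙ K (Fin 4 → K)} {i : Fin 4} (hP : P.rep i ≠ 0) :
    detForm (Nat.card F) P.rep ∈ homogeneousIdeal {P} ^ (Nat.card F + 1) := by
  set p := P.rep
  let t : MvPolynomial (Fin 4) K := C (p i)⁻¹ * X i
  let x : Fin 4 → MvPolynomial (Fin 4) K := fun j => X j - t * C (p j)
  have hx : ∀ j, x j ∈ homogeneousIdeal {P} := fun j =>
    mem_homogeneousIdeal_singleton fun s => by
      simp only [x, t, map_sub, map_mul, eval_X, eval_C, Pi.smul_apply, smul_eq_mul]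
      change s * p j - (p i)⁻¹ * (s * p i) * p j = 0
      field_simp
      ring
  have hX : ∀ j, X j = x j + t * C (p j) := fun j => by simp [x]
  have hdet : detForm (Nat.card F) p = Matrix.det (Matrix.of ![fun i => C (p i),
      fun i => C (p i ^ Nat.card F), x, fun i => x i ^ Nat.card F]) := by
    rw [detForm]
    simp only [hX, add_pow_natCard F, mul_pow, C_pow]
    simp [Matrix.det_succ_row_zero, Fin.sum_univ_succ, Fin.succAbove]
    ring
  rw [hdet, Matrix.det_apply]
  refine Ideal.sum_mem _ fun σ _ => Submodule.smul_of_tower_mem _ (Equiv.Perm.sign σ) ?_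
  rw [← Equiv.prod_comp σ.symm]
  simp only [Equiv.apply_symm_apply, Fin.prod_univ_four]
  have := Ideal.mul_mem_mul (Ideal.pow_mem_pow (hx (σ.symm 3)) (Nat.card F)) (hx (σ.symm 2))
  rw [← pow_succ] at this
  have h := Ideal.mul_mem_left _ (C (p (σ.symm 0)) * C (p (σ.symm 1) ^ Nat.card F)) this
  convert h using 1
  simp
  ring

end Cones

/-! ### Freeness holds at a general point. -/

section GeneralPoint

variable {F : Type*} [Field F] [Finite F] {K : Type*} [Field K] [Algebra F K]

/-- F being finite, there are finitely many nonzero rational linear forms; their product is a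
nonzero form, so over an infinite field it is nonzero somewhere. -/
theorem forGeneralPoint_isFree [Infinite K] :
    ForGeneralPoint fun P : ℙ K (Fin 4 → K) => IsFree F P.rep := by
  classical
  have := Fintype.ofFinite F
  let l : (Fin 4 → F) → MvPolynomial (Fin 4) K := fun c => ∑ i, C (inclusion K c i) * X i
  have hl : ∀ c v, eval v (l c) = inclusion K c ⬝ᵥ v := fun c v => by simp [l, dotProduct]
  let s : Finset (Fin 4 → F) := Finset.univ.filter (· ≠ 0)
  have hhom : (∏ c ∈ s, l c).IsHomogeneous (∑ c ∈ s, 1) :=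
    IsHomogeneous.prod _ _ _ fun c _ => IsHomogeneous.sum _ _ _ fun i _ => by
      simpa using (isHomogeneous_C (Fin 4) (inclusion K c i)).mul (isHomogeneous_X K i)
  have hne : ∏ c ∈ s, l c ≠ 0 := by
    refine Finset.prod_ne_zero_iff.2 fun c hc h0 => (Finset.mem_filter.1 hc).2 ?_
    refine inclusion_injective K (funext fun i => ?_)
    have := hl c (Pi.single i 1)
    rw [h0, dotProduct_single, mul_one, map_zero] at this
    rw [← this, map_zero, Pi.zero_apply]
  have hiff : ∀ v, eval v (∏ c ∈ s, l c) ≠ 0 ↔ IsFree F v := fun v => by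
    rw [map_prod, Finset.prod_ne_zero_iff]
    simp only [hl, s, Finset.mem_filter, Finset.mem_univ, true_and, IsFree]
  refine ⟨(zeroSet (∏ c ∈ s, l c))ᶜ, ⟨{∏ c ∈ s, l c}, ?_, by simp⟩, ?_, fun P hP =>
    (hiff _).1 hP⟩
  · rintro f rfl
    exact ⟨_, hhom⟩
  · obtain ⟨v, hv⟩ : ∃ v : Fin 4 → K, IsFree F v := by
      simp only [← hiff]
      by_contra! h
      exact hne (MvPolynomial.funext fun v => by rw [h v, map_zero])
    have hv0 : v ≠ 0 := by
      rintro rfl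
      exact hv.apply_ne_zero 0 rfl
    obtain ⟨a, ha⟩ := Projectivization.exists_smul_eq_mk_rep K v hv0
    refine ⟨Projectivization.mk K v hv0, (hiff _).2 ?_⟩
    rw [← ha, Units.smul_def]
    intro c hc
    rw [dotProduct_smul]
    exact smul_ne_zero a.ne_zero (hv c hc)

end GeneralPoint

end Geproci

/-- The points over a finite field on the lines of a partial spread form a geproci set over the
algebraic closure, and the general projection is cut out by the determinantal cone and by the join
of the lines with the centre of projection. -/
theorem corollary1 {F : Type*} [Field F] [Finite F] {K : Type*} [Field K] [Algebra F K]
    [IsAlgClosure F K] (q : ℕ) (hq : Nat.card F = q)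
    (S : Finset (Submodule F (Fin 4 → F))) (hS : IsPartialSpread S) (s : ℕ) (hs : S.card = s) :
    IsGeproci (pointsOf K S) s (q + 1) ∧
    ForGeneralPoint fun P : ℙ K (Fin 4 → K) =>
      P ∉ pointsOf K S ∧
      IsConeWithVertex P (q + 1) (detForm q P.rep) ∧
      ∃ G : MvPolynomial (Fin 4) K, IsConeWithVertex P s G ∧ zeroSet G = join K S P ∧
        ∀ (H : Submodule K (Fin 4 → K)) (h : IsCompl H P.submodule) (e : H ≃ₗ[K] (Fin 3 → K)),
          IsCompleteIntersectionOf (imageUnder (projectionFrom P H h e) (pointsOf K S)) s (q + 1)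
            (restrictToPlane H e G) (restrictToPlane H e (detForm q P.rep)) := by
  subst hq hs
  have : IsAlgClosed K := IsAlgClosure.isAlgClosed F
  have : Infinite K := IsAlgClosed.instInfinite
  -- The coordinates depend only on the lines and serve every P at once.
  choose! A hA hL using fun L hLS => exists_matrix_of_finrank_eq_two L (hS.1 L hLS)
  have key : ∀ P : ℙ K (Fin 4 → K), IsFree F P.rep →
      ∀ (H : Submodule K (Fin 4 → K)) (h : IsCompl H P.submodule) (e : H ≃ₗ[K] (Fin 3 → K)),
        IsCompleteIntersectionOf (imageUnder (projectionFrom P H h e) (pointsOf K S)) S.card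
          (Nat.card F + 1)
          (restrictToPlane H e (∏ L ∈ S, joinForm ((A L).map (algebraMap F K)) P.rep))
          (restrictToPlane H e (detForm (Nat.card F) P.rep)) := fun P hP H h e => by
    rw [restrictToPlane_eq_pullback, restrictToPlane_eq_pullback]
    exact isCompleteIntersectionOf_projection (projectionFrom_apply_symm P H h e)
      (projectionFrom_rep P H h e) (exists_projectionFrom_apply P H h e) hP S hS.2 A hA hL
  obtain ⟨U, hU, hne, hfree⟩ := forGeneralPoint_isFree (F := F) (K := K)
  refine ⟨⟨finite_pointsOf S, U, hU, hne, fun P hPU => ?_⟩, U, hU, hne, fun P hPU => ?_⟩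
  · have hP := hfree P hPU
    exact ⟨hP.notMem_pointsOf S, fun H h e => ⟨_, _, key P hP H h e⟩⟩
  · have hP := hfree P hPU
    exact ⟨hP.notMem_pointsOf S,
      ⟨detForm_ne_zero hP, isHomogeneous_detForm _ _,
        detForm_mem_homogeneousIdeal_pow (hP.apply_ne_zero 0)⟩,
      _, isConeWithVertex_prod_joinForm hP S A hA, zeroSet_prod_joinForm hP S A hA hL, key P hP⟩
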